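/- **Setting.** A simplicial complex is a finite collection of nonempty finite sets (simplices) closed under passing to nonempty subsets; $\dim\sigma=|\sigma|-1$ and $\chi(\mathcal K)=\sum_{\sigma\in\mathcal K}(-1)^{\dim\sigma}$. A one-parameter filtration of $\mathcal K$ is a family $\mathcal F=(\mathcal F_t)_{t\in\mathbb R}$ of subcomplexes of $\mathcal K$ with $\mathcal F_t\subseteq\mathcal F_{t'}$ for $t\le t'$. It is *finitely generated* if for each $\sigma\in\mathcal K$ the set $\{t:\sigma\in\mathcal F_t\}$ has finitely many minimal elements and each of its elements lies above a minimal one (so this set is empty or of the form $[a,\infty)$). Its Euler characteristic curve is $\chi_{\mathcal F}:t\mapsto\chi(\mathcal F_t)$. **Persistence diagrams.** Fix a field of coefficients. For $k\ge0$, the degree $k$ persistence diagram $\mathcal D_k$ of $\mathcal F$ is the finite multiset of points $(a,b)$ with $a\in\mathbb R$, $a<b\le\infty$, where $(a,b)$ is counted with the number of degree $k$ simplicial homology classes that are born at $a$ and die at $b$. Explicitly, write $\beta_k(L,L')$ for the rank of $H_k(L)\to H_k(L')$ for $L\subseteq L'$, and put $\mathcal F_{<a}=\bigcup_{s<a}\mathcal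 F_s$, $\mathcal F_\infty=\bigcup_s\mathcal F_s$. The multiplicity of $(a,b)$ is $$\beta_k(\mathcal F_a,\mathcal F_{<b})-\beta_k(\mathcal F_a,\mathcal F_b)-\beta_k(\mathcal F_{<a},\mathcal F_{<b})+\beta_k(\mathcal F_{<a},\mathcal F_b)$$ for $b<\infty$, and $\beta_k(\mathcal F_a,\mathcal F_\infty)-\beta_k(\mathcal F_{<a},\mathcal F_\infty)$ for $b=\infty$. **Wasserstein distance.** For two such multisets $\mathcal D,\mathcal D'$, let $$W_1(\mathcal D,\mathcal D')=\inf_\eta\sum_{x\in\mathcal D\cup\Delta}\|x-\eta(x)\|_\infty\in[0,\infty],$$ the infimum being over all bijections $\eta:\mathcal D\cup\Delta\to\mathcal D'\cup\Delta$, where $\Delta=\{(s,s):s\in\mathbb R\}$ and each point of $\Delta$ has countably infinite multiplicity. Here $|\infty-\infty|=0$ and $|\infty-s|=\infty$ for $s\in\mathbb R$. **Signed Wasserstein distance.** The signed barcode of a finite $\mathbb Z$-linear combination $\varphi$ of indicator functions $\mathbf 1_{[u,\infty)}$ is the unique pair $(\mathcal B^+,\mathcal B^-)$ of disjoint finite multisets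 of real numbers with $\varphi=\sum_{u\in\mathcal B^+}\mathbf 1_{[u,\infty)}-\sum_{v\in\mathcal B^-}\mathbf 1_{[v,\infty)}$. For $\varphi,\varphi'$ with signed barcodes $(\mathcal B^+,\mathcal B^-)$ and $(\mathcal B'^+,\mathcal B'^-)$, let $\widehat d_1(\varphi,\varphi')\in[0,\infty]$ be the infimum of all $\varepsilon>0$ for which there is a bijection of multisets $h:\mathcal B^+\cup\mathcal B'^-\to\mathcal B^-\cup\mathcal B'^+$ (unions counted with multiplicity) with $\sum_u|u-h(u)|\le\varepsilon$. **Lemma.** Let $\mathcal F$ and $\mathcal F'$ be finitely generated one-parameter filtrations of simplicial complexes $\mathcal K$ and $\mathcal K'$, with degree $k$ persistence diagrams $\mathcal D_k$ and $\mathcal D'_k$. Then $$\widehat d_1(\chi_{\mathcal F},\chi_{\mathcal F'})\;\le\;2\sum_{k\ge0}W_1(\mathcal D_k,\mathcal D'_k).$$ -/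

import Mathlib

open scoped ENNReal

set_option maxSynthPendingDepth 3

noncomputable section

namespace EulerPersistence

/-! ### Finite simplicial complexes and one-parameter filtrations -/

/-- A finite abstract simplicial complex with vertices in `V`: a finite collection of nonempty
finite sets of vertices, closed under passing to nonempty subsets. -/
structure FiniteComplex (V : Type*) extends PreAbstractSimplicialComplex V where
  finite_faces : faces.Finite

/-- The Euler characteristic `∑ (-1) ^ dim σ`, where `dim σ = card σ - 1`
(each face is nonempty). -/
def eulerChar {V : Type*} (K : FiniteComplex V) : ℤ :=
  ∑ σ ∈ K.finite_faces.toFinset, (-1) ^ (σ.card - 1)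

/-- A one-parameter filtration of `K`: an increasing family of subcomplexes indexed by `ℝ`. -/
structure Filtration {V : Type*} (K : FiniteComplex V) where
  complex : ℝ → PreAbstractSimplicialComplex V
  mono : Monotone complex
  complex_le : ∀ t, complex t ≤ K.toPreAbstractSimplicialComplex

namespace Filtration

variable {V : Type*} {K : FiniteComplex V} (F : Filtration K)

/-- The subcomplex at time `t`, as a finite complex. -/
def finiteComplex (t : ℝ) : FiniteComplex V where
  toPreAbstractSimplicialComplex := F.complex t
  finite_faces := K.finite_faces.subset (F.complex_le t)

/-- The Euler characteristic curve `t ↦ χ(F_t)`. -/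
def eulerCurve : ℝ → ℤ := fun t => eulerChar (F.finiteComplex t)

/-- The set of times at which the simplex `σ` is present. -/
def support (σ : Finset V) : Set ℝ := {t | σ ∈ (F.complex t).faces}

/-- The births of a simplex: the minimal elements of its support. -/
def births (σ : Finset V) : Set ℝ := {t | Minimal (· ∈ F.support σ) t}

/-- The support of each simplex is generated (as an upper set) by its minimal elements, which
are finite in number. (An empty support is allowed, it has no minimal element.) -/
def FinitelyGenerated : Prop :=
  ∀ σ ∈ K.faces, (F.births σ).Finite ∧ ∀ t ∈ F.support σ, ∃ s ∈ F.births σ, s ≤ t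

/-- The critical values: the births of all simplices. -/
def criticalValues : Set ℝ := ⋃ σ ∈ K.faces, F.births σ

theorem births_subsingleton (σ : Finset V) : (F.births σ).Subsingleton := by
  intro a ha b hb
  rcases le_total a b with h | h
  · exact le_antisymm h (hb.2 ha.1 h)
  · exact le_antisymm (ha.2 hb.1 h) h

theorem finite_criticalValues : F.criticalValues.Finite :=
  K.finite_faces.biUnion fun σ _ => (F.births_subsingleton σ).finite

/-- The union `F_{<a}` of all `F_s` with `s < a`. -/
def before (a : ℝ) : PreAbstractSimplicialComplex V := ⨆ s : Set.Iio a, F.complex s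

/-- The union of all `F_s`. -/
def total : PreAbstractSimplicialComplex V := ⨆ s : ℝ, F.complex s

theorem before_le (a : ℝ) : F.before a ≤ F.complex a :=
  iSup_le fun s => F.mono s.2.le

theorem le_before {a b : ℝ} (h : a < b) : F.complex a ≤ F.before b :=
  le_iSup (fun s : Set.Iio b => F.complex s) ⟨a, h⟩

theorem complex_le_total (a : ℝ) : F.complex a ≤ F.total :=
  le_iSup F.complex a

end Filtration

/-! ### Simplicial homology over a field

Vertices are totally ordered, and each simplex is oriented by this order. -/

section Homology

variable (𝕜 : Type*) [Field 𝕜] {V : Type*}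

/-- The `k`-chains of `L`: formal combinations of its simplices with `k + 1` vertices. -/
def chains (L : PreAbstractSimplicialComplex V) (k : ℕ) : Submodule 𝕜 (Finset V →₀ 𝕜) :=
  Finsupp.supported 𝕜 𝕜 {σ | σ ∈ L.faces ∧ σ.card = k + 1}

variable {L L' : PreAbstractSimplicialComplex V}

theorem chains_mono (h : L ≤ L') (k : ℕ) : chains 𝕜 L k ≤ chains 𝕜 L' k :=
  Finsupp.supported_mono fun _ hσ => ⟨h hσ.1, hσ.2⟩

variable [LinearOrder V]

/-- The simplicial boundary operator
`[v₀ < ⋯ < vₖ] ↦ ∑ᵢ (-1)ⁱ [v₀ < ⋯ v̂ᵢ ⋯ < vₖ]` for `k ≥ 1`; it vanishes on vertices. -/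
def boundary : (Finset V →₀ 𝕜) →ₗ[𝕜] (Finset V →₀ 𝕜) :=
  Finsupp.linearCombination 𝕜 fun σ =>
    if 2 ≤ σ.card then
      ∑ v ∈ σ, Finsupp.single (σ.erase v) ((-1 : 𝕜) ^ (σ.filter (· < v)).card)
    else 0

/-- The `k`-cycles. -/
def cycles (L : PreAbstractSimplicialComplex V) (k : ℕ) : Submodule 𝕜 (Finset V →₀ 𝕜) :=
  chains 𝕜 L k ⊓ LinearMap.ker (boundary 𝕜)

/-- The `k`-boundaries. -/
def boundaries (L : PreAbstractSimplicialComplex V) (k : ℕ) : Submodule 𝕜 (Finset V →₀ 𝕜) :=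
  (chains 𝕜 L (k + 1)).map (boundary 𝕜)

/-- Simplicial homology `H_k(L)`: cycles modulo boundaries. -/
abbrev Homology (L : PreAbstractSimplicialComplex V) (k : ℕ) : Type _ :=
  cycles 𝕜 L k ⧸ (boundaries 𝕜 L k).submoduleOf (cycles 𝕜 L k)

theorem cycles_mono (h : L ≤ L') (k : ℕ) : cycles 𝕜 L k ≤ cycles 𝕜 L' k :=
  inf_le_inf_right _ (chains_mono 𝕜 h k)

theorem boundaries_mono (h : L ≤ L') (k : ℕ) : boundaries 𝕜 L k ≤ boundaries 𝕜 L' k :=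
  Submodule.map_mono (chains_mono 𝕜 h (k + 1))

/-- The map `H_k(L) → H_k(L')` induced by an inclusion `L ⊆ L'`. -/
def homologyMap (h : L ≤ L') (k : ℕ) : Homology 𝕜 L k →ₗ[𝕜] Homology 𝕜 L' k :=
  Submodule.mapQ _ _ (Submodule.inclusion (cycles_mono 𝕜 h k))
    fun _ hx => boundaries_mono 𝕜 h k hx

/-- The `k`-th persistent Betti number of an inclusion `L ⊆ L'`: the rank of
`H_k(L) → H_k(L')`. -/
def persistentBetti (h : L ≤ L') (k : ℕ) : ℕ :=
  Module.finrank 𝕜 (LinearMap.range (homologyMap 𝕜 h k))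

end Homology

/-! ### Persistence diagrams -/

/-- A bar `[a, b)`, recorded as the point `(a, b)`, with `b = ⊤` allowed. -/
abbrev Bar : Type := ℝ × WithTop ℝ

namespace Filtration

variable {V : Type*} [LinearOrder V] {K : FiniteComplex V} (F : Filtration K)

variable (𝕜 : Type*) [Field 𝕜]

/-- For `a < b`, the number of degree `k` classes born exactly at `a` and dying exactly at `b`:
those alive from `a` until just before `b` but not at `b`, minus those among them which were
already alive just before `a`. -/
def multiplicity (k : ℕ) {a b : ℝ} (h : a < b) : ℕ :=
  (((persistentBetti 𝕜 (F.le_before h) k : ℤ) -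
      persistentBetti 𝕜 (F.mono h.le) k) -
    ((persistentBetti 𝕜 ((F.before_le a).trans (F.le_before h)) k : ℤ) -
      persistentBetti 𝕜 ((F.before_le a).trans (F.mono h.le)) k)).toNat

/-- The number of degree `k` classes born exactly at `a` which never die. -/
def multiplicityTop (k : ℕ) (a : ℝ) : ℕ :=
  ((persistentBetti 𝕜 (F.complex_le_total a) k : ℤ) -
    persistentBetti 𝕜 ((F.before_le a).trans (F.complex_le_total a)) k).toNat

/-- The degree `k` persistence diagram: each point `(a, b)` with critical values `a < b`, and each
point `(a, ⊤)` with `a` a critical value, taken with its multiplicity. -/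
def persistenceDiagram (k : ℕ) : Multiset Bar :=
  ∑ a ∈ F.finite_criticalValues.toFinset,
    ((∑ b ∈ F.finite_criticalValues.toFinset,
        if h : a < b then F.multiplicity 𝕜 k h • {((a, (b : WithTop ℝ)) : Bar)} else 0) +
      F.multiplicityTop 𝕜 k a • {((a, ⊤) : Bar)})

end Filtration

/-! ### The `1`-Wasserstein distance between persistence diagrams -/

/-- The distance between two death times; an infinite death is at distance `0` from itself and
`∞` from each finite one. -/
def deathDist : WithTop ℝ → WithTop ℝ → ℝ≥0∞
  | ⊤, ⊤ => 0
  | ⊤, WithTop.some _ => ∞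
  | WithTop.some _, ⊤ => ∞
  | WithTop.some x, WithTop.some y => ENNReal.ofReal |x - y|

/-- The `ℓ^∞` distance between two points of extended diagrams. -/
def barDist (p q : Bar) : ℝ≥0∞ := max (ENNReal.ofReal |p.1 - q.1|) (deathDist p.2 q.2)

/-- The points of `D ∪ Δ`: those of the multiset `D`, and those of the diagonal `Δ`, each point of
which has countably infinite multiplicity. -/
abbrev WithDiagonal (D : Multiset Bar) : Type := D.ToType ⊕ (ℝ × ℕ)

/-- The underlying point of an element of `D ∪ Δ`. -/
def WithDiagonal.point {D : Multiset Bar} : WithDiagonal D → Bar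
  | Sum.inl x => x.1
  | Sum.inr s => (s.1, (s.1 : WithTop ℝ))

/-- The `1`-Wasserstein distance: the infimum of `∑ ‖x - η x‖_∞` over all
bijections `η : D ∪ Δ → D' ∪ Δ`. -/
def wasserstein (D D' : Multiset Bar) : ℝ≥0∞ :=
  ⨅ η : WithDiagonal D ≃ WithDiagonal D', ∑' x, barDist x.point (η x).point

/-! ### The signed `1`-Wasserstein distance between finitely presented functions on `ℝ` -/

/-- `(P, N)` is the signed barcode of `φ`: disjoint finite multisets with
`φ = ∑_{u ∈ P} 1_{[u, ∞)} - ∑_{v ∈ N} 1_{[v, ∞)}`. -/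
structure IsSignedBarcode (φ : ℝ → ℤ) (P N : Multiset ℝ) : Prop where
  eq_sum : ∀ t, φ t = (P.map fun u => (Set.Ici u).indicator (1 : ℝ → ℤ) t).sum -
    (N.map fun v => (Set.Ici v).indicator (1 : ℝ → ℤ) t).sum
  disjoint : Disjoint P N

/-- The cost of a bijection between finite multisets of reals. -/
def matchingCost {C C' : Multiset ℝ} (h : C.ToType ≃ C'.ToType) : ℝ :=
  ∑ u, |u.1 - (h u).1|

/-- The signed `1`-Wasserstein distance: the infimum of the `ε > 0` for which the signed
barcodes `(P, N)` of `φ` and `(P', N')` of `φ'` admit a bijection `P ∪ N' → N ∪ P'` of cost at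
most `ε`. (It is `∞` if there is none.) -/
def signedWasserstein (φ φ' : ℝ → ℤ) : ℝ≥0∞ :=
  sInf {e : ℝ≥0∞ | ∃ ε : ℝ, 0 < ε ∧ e = ENNReal.ofReal ε ∧
    ∃ P N P' N' : Multiset ℝ, IsSignedBarcode φ P N ∧ IsSignedBarcode φ' P' N' ∧
      ∃ h : (P + N').ToType ≃ (N + P').ToType, matchingCost h ≤ ε}

end EulerPersistence

end

/-!
Write `β_k(t) = dim H_k(F_t)`. The Euler curve is `∑ (-1)^k β_k(t)` by the Euler–Poincaré formula
(`eulerChar_eq_sum_betti`), and `β_k(t)` is the number of bars `[a, b)` of the degree `k` diagram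
that contain `t` (`Filtration.FinitelyGenerated.barsAlive_persistenceDiagram`). Since
`1_[a, b) = 1_[a, ∞) - 1_[b, ∞)`, the Euler curve is presented by two multisets of reals: births of
bars of even degree and finite deaths of bars of odd degree on the positive side, the remaining
births and finite deaths on the negative side.

For the count of bars, `β_k(L, L') = dim Z_k(L) - dim (Z_k(L) ∩ B_k(L'))`. The multiplicity of a
bar is therefore a mixed second difference of `(L, L') ↦ dim (Z_k(L) ∩ B_k(L'))`. It is nonnegative
(`finrankBounding_supermodular`), and the sum of the multiplicities telescopes, because the
filtration changes only at its critical values (`Filtration.FinitelyGenerated.sum_jumps`).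

A bijection of diagrams with diagonal that pairs `(a, b)` with `(a', b')` pairs the births `a`, `a'`
and the finite deaths `b`, `b'`, at a cost of at most twice the `ℓ^∞` distance. This is the source
of the factor `2`. A point of the diagonal has equal birth and death, so it occurs in both the
source and the target of the resulting matching of reals. Common points of source and target can be
cancelled without raising the cost, by the triangle inequality (`Matched.cancel`). So the points of
the diagonal disappear (`matched_of_wasserstein_lt`), and so does the common part of the positive
and negative sides, which leaves a matching of the signed barcodes
(`signedWasserstein_le_of_matched`).
-/

noncomputable section

namespace EulerPersistence

/-! ### Matchings between multisets of reals -/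

/-- There is a bijection between the multisets `A` and `B` of total cost at most `c`. The bijection
is encoded by its graph, a multiset of pairs with marginals `A` and `B`. -/
def Matched (A B : Multiset ℝ) (c : ℝ≥0∞) : Prop :=
  ∃ M : Multiset (ℝ × ℝ), M.map Prod.fst = A ∧ M.map Prod.snd = B ∧
    (M.map fun p => edist p.1 p.2).sum ≤ c

namespace Matched

variable {A A' B B' C : Multiset ℝ} {c c' : ℝ≥0∞}

theorem zero : Matched 0 0 0 := ⟨0, by simp⟩

theorem singleton (x y : ℝ) : Matched {x} {y} (edist x y) := ⟨{(x, y)}, by simp⟩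

theorem add (h : Matched A B c) (h' : Matched A' B' c') :
    Matched (A + A') (B + B') (c + c') := by
  obtain ⟨M, rfl, rfl, hM⟩ := h
  obtain ⟨M', rfl, rfl, hM'⟩ := h'
  exact ⟨M + M', by simp, by simp, by simpa using add_le_add hM hM'⟩

theorem symm (h : Matched A B c) : Matched B A c := by
  obtain ⟨M, rfl, rfl, hM⟩ := h
  refine ⟨M.map Prod.swap, by simp, by simp, ?_⟩
  simpa [Multiset.map_map, edist_comm] using hM

theorem mono (h : Matched A B c) (hc : c ≤ c') : Matched A B c' := by
  obtain ⟨M, hA, hB, hM⟩ := h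
  exact ⟨M, hA, hB, hM.trans hc⟩

theorem sum {ι : Type*} (s : Finset ι) {A B : ι → Multiset ℝ} {c : ι → ℝ≥0∞}
    (h : ∀ i ∈ s, Matched (A i) (B i) (c i)) :
    Matched (∑ i ∈ s, A i) (∑ i ∈ s, B i) (∑ i ∈ s, c i) := by
  classical
  induction s using Finset.induction_on with
  | empty => simpa using zero
  | insert i s hi ih =>
    rw [Finset.sum_insert hi, Finset.sum_insert hi, Finset.sum_insert hi]
    exact (h i (by simp)).add (ih fun j hj => h j (by simp [hj]))

/-- If the common point `x` is matched to `y` on one side and to `z` on the other, then `z` can be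
matched to `y` directly, at no greater cost by the triangle inequality. -/
theorem cancel_cons {x : ℝ} (h : Matched (x ::ₘ A) (x ::ₘ B) c) : Matched A B c := by
  obtain ⟨M, hA, hB, hM⟩ := h
  obtain ⟨⟨x', y⟩, hp, rfl⟩ : ∃ p ∈ M, p.1 = x :=
    Multiset.mem_map.1 (hA ▸ Multiset.mem_cons_self x A)
  obtain ⟨M, rfl⟩ := Multiset.exists_cons_of_mem hp
  simp only [Multiset.map_cons, Multiset.cons_inj_right, Multiset.sum_cons] at hA hB hM
  by_cases hxy : y = x'
  · subst hxy
    exact ⟨M, hA, by simpa using hB, by simpa using hM⟩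
  · have hx : x' ∈ M.map Prod.snd :=
      (Multiset.mem_cons.1 (hB ▸ Multiset.mem_cons_self x' B)).resolve_left (Ne.symm hxy)
    obtain ⟨⟨z, w⟩, hq, rfl⟩ := Multiset.mem_map.1 hx
    obtain ⟨M, rfl⟩ := Multiset.exists_cons_of_mem hq
    simp only [Multiset.map_cons, Multiset.sum_cons] at hA hB hM
    refine ⟨(z, y) ::ₘ M, by simpa using hA, ?_, ?_⟩
    · rw [Multiset.cons_swap] at hB
      simpa using hB
    · rw [← add_assoc] at hM
      refine le_trans ?_ hM
      rw [Multiset.map_cons, Multiset.sum_cons]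
      gcongr
      rw [add_comm]
      exact edist_triangle z w y

theorem cancel (h : Matched (A + C) (B + C) c) : Matched A B c := by
  induction C using Multiset.induction_on with
  | empty => simpa using h
  | cons x C ih =>
    rw [Multiset.add_cons, Multiset.add_cons] at h
    exact ih h.cancel_cons

theorem exists_equiv {ε : ℝ} (hε : 0 ≤ ε) (h : Matched A B (ENNReal.ofReal ε)) :
    ∃ e : A.ToType ≃ B.ToType, matchingCost e ≤ ε := by
  obtain ⟨M, rfl, rfl, hM⟩ := h
  refine ⟨(M.mapEquiv Prod.fst).symm.trans (M.mapEquiv Prod.snd), ?_⟩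
  rw [← ENNReal.ofReal_le_ofReal_iff hε]
  refine le_trans (le_of_eq ?_) hM
  rw [matchingCost, ENNReal.ofReal_sum_of_nonneg fun _ _ => abs_nonneg _,
    ← (M.mapEquiv Prod.fst).sum_comp]
  conv_rhs => rw [← Multiset.map_univ_coe M, Multiset.map_map]
  rw [Finset.sum_eq_multiset_sum]
  congr 1
  refine Multiset.map_congr rfl fun p _ => ?_
  simp [edist_dist, Real.dist_eq]

end Matched

/-! ### From matchings of diagrams to matchings of births and deaths -/

/-- The finite part of a death time: `{b}` for `b` real, and `∅` for `⊤`. -/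
def finiteDeath : WithTop ℝ → Multiset ℝ
  | ⊤ => 0
  | WithTop.some b => {b}

/-- The births of the bars of a diagram. -/
def barBirths : Multiset Bar →+ Multiset ℝ :=
  Multiset.sumAddMonoidHom.comp (Multiset.mapAddMonoidHom fun p => {p.1})

/-- The finite deaths of the bars of a diagram. -/
def barDeaths : Multiset Bar →+ Multiset ℝ :=
  Multiset.sumAddMonoidHom.comp (Multiset.mapAddMonoidHom fun p => finiteDeath p.2)

/-- Two bars at finite distance have both infinite deaths or both finite ones. The two matched
pairs, births and deaths, each cost at most the `ℓ^∞` distance. -/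
theorem matched_of_barDist_ne_top {p q : Bar} (h : barDist p q ≠ ∞) :
    Matched ({p.1} + finiteDeath q.2) ({q.1} + finiteDeath p.2) (2 * barDist p q) := by
  have hb : Matched {p.1} {q.1} (barDist p q) :=
    (Matched.singleton _ _).mono <| by
      rw [edist_dist, Real.dist_eq]
      exact le_max_left _ _
  have hd : Matched (finiteDeath q.2) (finiteDeath p.2) (barDist p q) := by
    have h' : deathDist p.2 q.2 ≤ barDist p q := le_max_right _ _
    obtain ⟨a, b⟩ := p
    obtain ⟨a', b'⟩ := q
    induction b using WithTop.recTopCoe with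
    | top =>
      induction b' using WithTop.recTopCoe with
      | top => exact Matched.zero.mono zero_le
      | coe y => exact absurd (top_le_iff.1 h') h
    | coe x =>
      induction b' using WithTop.recTopCoe with
      | top => exact absurd (top_le_iff.1 h') h
      | coe y =>
        refine (Matched.singleton y x).mono (le_trans (le_of_eq ?_) h')
        rw [edist_comm, edist_dist, Real.dist_eq]
        rfl
  rw [two_mul]
  exact hb.add hd

theorem sum_toType {α M : Type*} [DecidableEq α] [AddCommMonoid M] (D : Multiset α) (f : α → M) :
    ∑ x : D.ToType, f x.1 = (D.map f).sum := by
  conv_rhs => rw [← Multiset.map_univ_coe D, Multiset.map_map]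
  rfl

/-- Over a finite set of points of `D ∪ Δ` containing all of `D`, the births and the finite deaths
exceed those of `D` by the same multiset, since on the diagonal birth and death agree. -/
theorem exists_sum_births_deaths {D : Multiset Bar} (I : Finset (WithDiagonal D))
    (hI : ∀ x : D.ToType, Sum.inl x ∈ I) :
    ∃ R, ∑ x ∈ I, ({x.point.1} : Multiset ℝ) = barBirths D + R ∧
      ∑ x ∈ I, finiteDeath x.point.2 = barDeaths D + R := by
  classical
  obtain ⟨T, rfl⟩ : ∃ T, I = Finset.univ.disjSum T := by
    refine ⟨I.toRight, ?_⟩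
    have hleft : I.toLeft = Finset.univ := by
      ext x
      simp [hI]
    rw [← hleft, Finset.toLeft_disjSum_toRight]
  refine ⟨∑ s ∈ T, {s.1}, ?_, ?_⟩
  · rw [Finset.sum_disjSum]
    exact congrArg (· + _) (sum_toType D fun p => ({p.1} : Multiset ℝ))
  · rw [Finset.sum_disjSum]
    exact congrArg (· + _) (sum_toType D fun p => finiteDeath p.2)

theorem matched_of_wasserstein_lt {D D' : Multiset Bar} {c : ℝ≥0∞} (h : wasserstein D D' < c) :
    Matched (barBirths D + barDeaths D') (barBirths D' + barDeaths D) (2 * c) := by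
  classical
  obtain ⟨η, hη⟩ := iInf_lt_iff.1 h
  -- The points that lie in `D` or are sent to `D'`: all others contribute diagonal pairs only.
  let I : Finset (WithDiagonal D) :=
    Finset.univ.image Sum.inl ∪ Finset.univ.image fun y : D'.ToType => η.symm (Sum.inl y)
  obtain ⟨R, hb, hd⟩ := exists_sum_births_deaths I fun x => by simp [I]
  obtain ⟨R', hb', hd'⟩ := exists_sum_births_deaths (I.map η.toEmbedding) fun y => by
    simp [I, Finset.mem_map_equiv]
  rw [Finset.sum_map] at hb' hd'
  have hM := Matched.sum I fun x _ => matched_of_barDist_ne_top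
    (p := x.point) (q := (η x).point) (ENNReal.ne_top_of_tsum_ne_top hη.ne_top x)
  simp only [Finset.sum_add_distrib, hb, hd] at hM
  simp only [Equiv.coe_toEmbedding] at hb' hd'
  rw [hb', hd', ← Finset.mul_sum] at hM
  refine Matched.mono (Matched.cancel (C := R + R') ?_)
    (mul_le_mul_right ((ENNReal.sum_le_tsum I).trans hη.le) 2)
  convert hM using 1 <;> abel

/-! ### Dimension counts in simplicial homology -/

section Homology

open Module

variable (𝕜 : Type*) [Field 𝕜] {V : Type*} {L L' : PreAbstractSimplicialComplex V}

theorem finiteDimensional_chains (hL : L.faces.Finite) (k : ℕ) :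
    FiniteDimensional 𝕜 (chains 𝕜 L k) := by
  have : Finite {σ | σ ∈ L.faces ∧ σ.card = k + 1} := hL.subset fun _ h => h.1
  exact (Finsupp.supportedEquivFinsupp (R := 𝕜) (M := 𝕜) _).symm.finiteDimensional

theorem finrank_chains (hL : L.faces.Finite) (k : ℕ) :
    finrank 𝕜 (chains 𝕜 L k) = (hL.toFinset.filter fun σ => σ.card = k + 1).card := by
  have : Fintype {σ | σ ∈ L.faces ∧ σ.card = k + 1} := (hL.subset fun _ h => h.1).fintype
  rw [chains, (Finsupp.supportedEquivFinsupp (R := 𝕜) (M := 𝕜) _).finrank_eq,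
    finrank_finsupp_self, ← Set.toFinset_card]
  congr 1
  ext σ
  simp

theorem eulerChar_eq_sum_chains (K : FiniteComplex V) {n : ℕ}
    (hn : ∀ σ ∈ K.faces, σ.card ≤ n) :
    eulerChar K = ∑ k ∈ Finset.range n,
      (-1) ^ k * (finrank 𝕜 (chains 𝕜 K.toPreAbstractSimplicialComplex k) : ℤ) := by
  have hpos : ∀ σ ∈ K.faces, 0 < σ.card := fun σ hσ =>
    Finset.card_pos.2 (K.isRelLowerSet_faces hσ).1
  rw [eulerChar, ← Finset.sum_fiberwise_of_maps_to (t := Finset.range n)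
    (g := fun σ => σ.card - 1)]
  · refine Finset.sum_congr rfl fun k _ => ?_
    rw [finrank_chains 𝕜 K.finite_faces, mul_comm, ← nsmul_eq_mul, ← Finset.sum_const]
    refine Finset.sum_congr ?_ ?_
    · ext σ
      simp only [Finset.mem_filter, Set.Finite.mem_toFinset]
      refine and_congr_right fun hσ => ?_
      have := hpos σ hσ
      omega
    · intro σ hσ
      rw [(Finset.mem_filter.1 hσ).2, Nat.add_sub_cancel]
  · intro σ hσ
    rw [Set.Finite.mem_toFinset] at hσ
    have := hpos σ hσ
    have := hn σ hσ
    simp only [Finset.mem_range]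
    omega

variable [LinearOrder V]

theorem boundary_single (σ : Finset V) (c : 𝕜) :
    boundary 𝕜 (Finsupp.single σ c) = c • if 2 ≤ σ.card then
      ∑ v ∈ σ, Finsupp.single (σ.erase v) ((-1 : 𝕜) ^ (σ.filter (· < v)).card) else 0 :=
  Finsupp.linearCombination_single ..

/-- Erasing `v` lowers by one the position of each `w > v`, and no other. So erasing `v` then `w`,
or `w` then `v`, come with opposite signs. -/
theorem sign_erase_erase {σ : Finset V} {v w : V} (hv : v ∈ σ) (h : v < w) :
    (-1 : 𝕜) ^ (σ.filter (· < v)).card * (-1) ^ ((σ.erase v).filter (· < w)).card +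
      (-1) ^ (σ.filter (· < w)).card * (-1) ^ ((σ.erase w).filter (· < v)).card = 0 := by
  have h₁ : (σ.erase w).filter (· < v) = σ.filter (· < v) := by
    rw [Finset.filter_erase, Finset.erase_eq_of_notMem]
    simp [h.le]
  have h₂ : (σ.filter (· < w)).card = ((σ.erase v).filter (· < w)).card + 1 := by
    rw [Finset.filter_erase, Finset.card_erase_add_one]
    simp [hv, h]
  rw [h₁, h₂, pow_succ]
  ring

theorem boundary_boundary (x : Finset V →₀ 𝕜) : boundary 𝕜 (boundary 𝕜 x) = 0 := by
  induction x using Finsupp.induction_linear with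
  | zero => simp
  | add x y hx hy => simp [hx, hy]
  | single σ c =>
    rw [boundary_single, map_smul]
    split_ifs with hσ
    swap
    · simp
    by_cases hσ' : 3 ≤ σ.card
    swap
    · rw [map_sum, Finset.sum_eq_zero, smul_zero]
      intro v hv
      rw [boundary_single, if_neg, smul_zero]
      rw [Finset.card_erase_of_mem hv]
      omega
    have key : ∑ v ∈ σ, boundary 𝕜
        (Finsupp.single (σ.erase v) ((-1 : 𝕜) ^ (σ.filter (· < v)).card)) =
        ∑ p ∈ σ.sigma fun v => σ.erase v, Finsupp.single ((σ.erase p.1).erase p.2)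
          ((-1 : 𝕜) ^ (σ.filter (· < p.1)).card *
            (-1) ^ ((σ.erase p.1).filter (· < p.2)).card) := by
      rw [Finset.sum_sigma]
      refine Finset.sum_congr rfl fun v hv => ?_
      rw [boundary_single, if_pos, Finset.smul_sum]
      · simp
      · rw [Finset.card_erase_of_mem hv]
        omega
    rw [map_sum, key, Finset.sum_involution (fun p _ => ⟨p.2, p.1⟩), smul_zero]
    · rintro ⟨v, w⟩ hp
      simp only [Finset.mem_sigma, Finset.mem_erase] at hp ⊢
      obtain ⟨hv, hne, hw⟩ := hp
      rw [Finset.erase_right_comm (a := w), ← Finsupp.single_add, Finsupp.single_eq_zero]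
      rcases lt_or_gt_of_ne hne with h | h
      · rw [add_comm]
        exact sign_erase_erase 𝕜 hw h
      · exact sign_erase_erase 𝕜 hv h
    · rintro ⟨v, w⟩ hp _ he
      simp only [Finset.mem_sigma, Finset.mem_erase] at hp
      simp only [Sigma.mk.injEq] at he
      exact hp.2.1 he.1
    · rintro ⟨v, w⟩ hp
      simp only [Finset.mem_sigma, Finset.mem_erase] at hp ⊢
      exact ⟨hp.2.2, hp.2.1.symm, hp.1⟩
    · rintro ⟨v, w⟩ hp
      rfl

theorem boundary_mem_chains {k : ℕ} {x : Finset V →₀ 𝕜} (hx : x ∈ chains 𝕜 L (k + 1)) :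
    boundary 𝕜 x ∈ chains 𝕜 L k := by
  refine Submodule.sum_mem _ fun σ hσ => ?_
  obtain ⟨hσL, hcard⟩ := hx hσ
  refine Submodule.smul_mem _ _ ?_
  dsimp only
  rw [if_pos (by omega)]
  refine Submodule.sum_mem _ fun v hv => Finsupp.single_mem_supported _ _ ?_
  have hc : (σ.erase v).card = k + 1 := by
    rw [Finset.card_erase_of_mem hv]
    omega
  exact ⟨(L.isRelLowerSet_faces hσL).2 (Finset.erase_subset _ _)
    (Finset.card_pos.1 (by omega)), hc⟩

theorem boundaries_le_cycles (k : ℕ) : boundaries 𝕜 L k ≤ cycles 𝕜 L k := by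
  rintro _ ⟨x, hx, rfl⟩
  exact ⟨boundary_mem_chains 𝕜 hx, boundary_boundary 𝕜 x⟩

theorem cycles_zero : cycles 𝕜 L 0 = chains 𝕜 L 0 := by
  refine inf_eq_left.2 fun x hx => Finset.sum_eq_zero fun σ hσ => ?_
  have hc := (hx hσ).2
  simp [hc]

theorem finiteDimensional_cycles (hL : L.faces.Finite) (k : ℕ) :
    FiniteDimensional 𝕜 (cycles 𝕜 L k) :=
  have := finiteDimensional_chains 𝕜 hL k
  Submodule.finiteDimensional_of_le inf_le_left

/-- The dimension of the space of `k`-cycles of `L` that bound in `L'`. -/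
def finrankBounding (L L' : PreAbstractSimplicialComplex V) (k : ℕ) : ℕ :=
  finrank 𝕜 ↥(cycles 𝕜 L k ⊓ boundaries 𝕜 L' k)

theorem persistentBetti_add (hL : L.faces.Finite) (h : L ≤ L') (k : ℕ) :
    persistentBetti 𝕜 h k + finrankBounding 𝕜 L L' k = finrank 𝕜 (cycles 𝕜 L k) := by
  have := finiteDimensional_cycles 𝕜 hL k
  let f := homologyMap 𝕜 h k ∘ₗ Submodule.mkQ _
  have hr : LinearMap.range f = LinearMap.range (homologyMap 𝕜 h k) :=
    LinearMap.range_comp_of_range_eq_top _ (Submodule.range_mkQ _)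
  have hk : (LinearMap.ker f).map (cycles 𝕜 L k).subtype =
      cycles 𝕜 L k ⊓ boundaries 𝕜 L' k := by
    ext x
    simp only [Submodule.mem_map, LinearMap.mem_ker, Submodule.mem_inf]
    constructor
    · rintro ⟨y, hy, rfl⟩
      exact ⟨y.2, (Submodule.Quotient.mk_eq_zero
        ((boundaries 𝕜 L' k).submoduleOf (cycles 𝕜 L' k))).1 hy⟩
    · rintro ⟨hx, hx'⟩
      exact ⟨⟨x, hx⟩, (Submodule.Quotient.mk_eq_zero
        ((boundaries 𝕜 L' k).submoduleOf (cycles 𝕜 L' k))).2 hx', rfl⟩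
  rw [persistentBetti, ← hr, finrankBounding, ← hk, LinearEquiv.finrank_eq
    (Submodule.equivMapOfInjective _ (Submodule.subtype_injective _) _).symm]
  exact f.finrank_range_add_finrank_ker

theorem finrank_cycles_add (hL : L.faces.Finite) (k : ℕ) :
    finrank 𝕜 (cycles 𝕜 L (k + 1)) + finrank 𝕜 (boundaries 𝕜 L k) =
      finrank 𝕜 (chains 𝕜 L (k + 1)) := by
  have := finiteDimensional_chains 𝕜 hL (k + 1)
  have hk : (LinearMap.ker ((boundary 𝕜).domRestrict (chains 𝕜 L (k + 1)))).map
      (chains 𝕜 L (k + 1)).subtype = cycles 𝕜 L (k + 1) := by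
    ext x
    simp [cycles, and_comm]
  have hr : LinearMap.range ((boundary 𝕜).domRestrict (chains 𝕜 L (k + 1))) =
      boundaries 𝕜 L k := by
    ext x
    simp [boundaries]
  rw [← hk, ← hr, add_comm, LinearEquiv.finrank_eq
    (Submodule.equivMapOfInjective _ (Submodule.subtype_injective _) _).symm]
  exact LinearMap.finrank_range_add_finrank_ker _

/-- The Betti number of `L`. -/
abbrev betti (L : PreAbstractSimplicialComplex V) (k : ℕ) : ℕ :=
  persistentBetti 𝕜 (le_refl L) k

theorem betti_add (hL : L.faces.Finite) (k : ℕ) :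
    betti 𝕜 L k + finrank 𝕜 (boundaries 𝕜 L k) = finrank 𝕜 (cycles 𝕜 L k) := by
  rw [← persistentBetti_add 𝕜 hL le_rfl, finrankBounding,
    inf_eq_right.2 (boundaries_le_cycles 𝕜 k)]

/-- Euler–Poincaré: in the alternating sum of `dim C_k = dim Z_k + dim B_{k-1}` the dimensions of
the boundaries recombine to `dim Z_k - dim B_k`. -/
theorem eulerChar_eq_sum_betti (K : FiniteComplex V) {n : ℕ}
    (hn : ∀ σ ∈ K.faces, σ.card ≤ n) :
    eulerChar K = ∑ k ∈ Finset.range n,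
      (-1) ^ k * (betti 𝕜 K.toPreAbstractSimplicialComplex k : ℤ) := by
  have hK := K.finite_faces
  have partialSum : ∀ m, ∑ k ∈ Finset.range (m + 1),
      (-1) ^ k * (finrank 𝕜 (chains 𝕜 K.toPreAbstractSimplicialComplex k) : ℤ) =
      ∑ k ∈ Finset.range (m + 1),
        (-1) ^ k * (betti 𝕜 K.toPreAbstractSimplicialComplex k : ℤ) +
      (-1) ^ m * (finrank 𝕜 (boundaries 𝕜 K.toPreAbstractSimplicialComplex m) : ℤ) := by
    intro m
    induction m with
    | zero =>
      simp only [zero_add, Finset.sum_range_one, pow_zero, one_mul]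
      rw [← cycles_zero, ← betti_add 𝕜 hK]
      push_cast
      rfl
    | succ m ih =>
      rw [Finset.sum_range_succ, Finset.sum_range_succ _ (m + 1), ih,
        ← finrank_cycles_add 𝕜 hK, ← betti_add 𝕜 hK]
      push_cast
      ring
  rw [eulerChar_eq_sum_chains 𝕜 K hn]
  cases n with
  | zero => simp
  | succ m =>
    have htop : chains 𝕜 K.toPreAbstractSimplicialComplex (m + 1) = ⊥ := by
      have he : {σ | σ ∈ K.faces ∧ σ.card = m + 1 + 1} = ∅ := by
        refine Set.eq_empty_of_forall_notMem fun σ hσ => ?_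
        have := hn σ hσ.1
        have := hσ.2
        omega
      rw [chains, he, Finsupp.supported_empty]
    rw [partialSum, boundaries, htop, Submodule.map_bot, finrank_bot]
    simp

end Homology

/-! ### Persistence diagrams count the bars alive at each time -/

section Supermodular

open Module

variable (𝕜 : Type*) [Field 𝕜] {V : Type*} [LinearOrder V]

/-- This inequality makes multiplicities of bars nonnegative. It holds because
`(Z(L₂) ⊓ B(M₁)) ⊔ (Z(L₁) ⊓ B(M₂)) ≤ Z(L₂) ⊓ B(M₂)`, the two terms on the left intersecting in
`Z(L₁) ⊓ B(M₁)`. -/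
theorem finrankBounding_supermodular {L₁ L₂ M₁ M₂ : PreAbstractSimplicialComplex V}
    (hL₂ : L₂.faces.Finite) (hL : L₁ ≤ L₂) (hM : M₁ ≤ M₂) (k : ℕ) :
    finrankBounding 𝕜 L₂ M₁ k + finrankBounding 𝕜 L₁ M₂ k ≤
      finrankBounding 𝕜 L₂ M₂ k + finrankBounding 𝕜 L₁ M₁ k := by
  have := finiteDimensional_cycles 𝕜 hL₂ k
  have := finiteDimensional_cycles 𝕜 (hL₂.subset hL) k
  have hZ := cycles_mono 𝕜 hL k
  have hB := boundaries_mono 𝕜 hM k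
  have hinf : (cycles 𝕜 L₂ k ⊓ boundaries 𝕜 M₁ k) ⊓ (cycles 𝕜 L₁ k ⊓ boundaries 𝕜 M₂ k) =
      cycles 𝕜 L₁ k ⊓ boundaries 𝕜 M₁ k := by
    rw [inf_inf_inf_comm, inf_eq_right.2 hZ, inf_eq_left.2 hB]
  have := Submodule.finrank_sup_add_finrank_inf_eq
    (cycles 𝕜 L₂ k ⊓ boundaries 𝕜 M₁ k) (cycles 𝕜 L₁ k ⊓ boundaries 𝕜 M₂ k)
  rw [hinf] at this
  simp only [finrankBounding]
  rw [← this]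
  gcongr
  exact Submodule.finrank_mono <| sup_le (inf_le_inf_left _ hB) (inf_le_inf_right _ hZ)

end Supermodular

/-- The value at `t` of the sum of the indicator functions of `[u, ∞)`, for `u ∈ A`. -/
def steps (t : ℝ) : Multiset ℝ →+ ℤ :=
  Multiset.sumAddMonoidHom.comp
    (Multiset.mapAddMonoidHom fun u => (Set.Ici u).indicator (1 : ℝ → ℤ) t)

theorem steps_singleton (t u : ℝ) : steps t {u} = if u ≤ t then 1 else 0 := by
  simp [steps, Set.indicator_apply]

/-- The number of bars `[a, b)` of a diagram that contain `t`. -/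
def barsAlive (t : ℝ) : Multiset Bar →+ ℤ :=
  (steps t).comp barBirths - (steps t).comp barDeaths

theorem barsAlive_coe (t a b : ℝ) :
    barsAlive t {((a, (b : WithTop ℝ)) : Bar)} =
      (if a ≤ t then 1 else 0) - if b ≤ t then 1 else 0 := by
  rw [← steps_singleton, ← steps_singleton]
  simp only [barsAlive, barBirths, barDeaths, AddMonoidHom.sub_apply, AddMonoidHom.comp_apply]
  simp only [Multiset.coe_mapAddMonoidHom, Multiset.coe_sumAddMonoidHom, Multiset.map_singleton,
    Multiset.sum_singleton]
  rfl

theorem barsAlive_top (t a : ℝ) :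
    barsAlive t {((a, ⊤) : Bar)} = if a ≤ t then 1 else 0 := by
  rw [← steps_singleton]
  simp only [barsAlive, barBirths, barDeaths, AddMonoidHom.sub_apply, AddMonoidHom.comp_apply]
  simp only [Multiset.coe_mapAddMonoidHom, Multiset.coe_sumAddMonoidHom, Multiset.map_singleton,
    Multiset.sum_singleton, finiteDeath, map_zero, sub_zero]

namespace Filtration

variable {V : Type*} {K : FiniteComplex V} {F : Filtration K}

theorem finite_faces_complex (F : Filtration K) (t : ℝ) : (F.complex t).faces.Finite :=
  K.finite_faces.subset (F.complex_le t)

theorem finite_faces_before (F : Filtration K) (t : ℝ) : (F.before t).faces.Finite :=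
  (F.finite_faces_complex t).subset (F.before_le t)

theorem FinitelyGenerated.exists_critical (hF : F.FinitelyGenerated) {σ : Finset V} {t : ℝ}
    (hσ : σ ∈ (F.complex t).faces) :
    ∃ c ∈ F.finite_criticalValues.toFinset, c ≤ t ∧ σ ∈ (F.complex c).faces := by
  have hK := F.complex_le t hσ
  obtain ⟨c, hc, hct⟩ := (hF σ hK).2 t hσ
  refine ⟨c, ?_, hct, hc.1⟩
  rw [Set.Finite.mem_toFinset]
  exact Set.mem_biUnion hK hc

theorem FinitelyGenerated.complex_eq (hF : F.FinitelyGenerated) {s t : ℝ} (hst : s ≤ t)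
    (h : ∀ c ∈ F.finite_criticalValues.toFinset, c ≤ t → c ≤ s) :
    F.complex s = F.complex t := by
  refine le_antisymm (F.mono hst) fun σ hσ => ?_
  obtain ⟨c, hc, hct, hσc⟩ := hF.exists_critical hσ
  exact F.mono (h c hc hct) hσc

theorem FinitelyGenerated.before_eq (hF : F.FinitelyGenerated) {s t : ℝ} (hst : s < t)
    (h : ∀ c ∈ F.finite_criticalValues.toFinset, c < t → c ≤ s) :
    F.before t = F.complex s := by
  refine le_antisymm (iSup_le fun u σ hσ => ?_) (F.le_before hst)
  obtain ⟨c, hc, hcu, hσc⟩ := hF.exists_critical hσ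
  exact F.mono (h c hc (hcu.trans_lt u.2)) hσc

/-- The jumps of any invariant of the complexes `F_t` telescope over the critical values. -/
theorem FinitelyGenerated.sum_jumps (hF : F.FinitelyGenerated)
    (Ψ : PreAbstractSimplicialComplex V → ℤ) {s t : ℝ} (hst : s ≤ t) :
    ∑ c ∈ F.finite_criticalValues.toFinset with s < c ∧ c ≤ t,
      (Ψ (F.complex c) - Ψ (F.before c)) = Ψ (F.complex t) - Ψ (F.complex s) := by
  induction hn : (F.finite_criticalValues.toFinset.filter fun c => s < c ∧ c ≤ t).card
    using Nat.strong_induction_on generalizing s with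
  | _ n ih =>
  rcases (F.finite_criticalValues.toFinset.filter fun c => s < c ∧ c ≤ t).eq_empty_or_nonempty
    with h | h
  · rw [h, Finset.sum_empty, hF.complex_eq hst, sub_self]
    intro c hc hct
    by_contra! hsc
    have : c ∈ F.finite_criticalValues.toFinset.filter fun c => s < c ∧ c ≤ t :=
      Finset.mem_filter.2 ⟨hc, hsc, hct⟩
    simp [h] at this
  · obtain ⟨m, hm, hmin⟩ := Finset.exists_min_image _ id h
    obtain ⟨hmS, hsm, hmt⟩ := Finset.mem_filter.1 hm
    have hsplit : (F.finite_criticalValues.toFinset.filter fun c => s < c ∧ c ≤ t) =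
        insert m (F.finite_criticalValues.toFinset.filter fun c => m < c ∧ c ≤ t) := by
      ext c
      simp only [Finset.mem_filter, Finset.mem_insert]
      constructor
      · rintro ⟨hc, hsc, hct⟩
        rcases (hmin c (Finset.mem_filter.2 ⟨hc, hsc, hct⟩)).eq_or_lt with h | h
        · exact Or.inl h.symm
        · exact Or.inr ⟨hc, h, hct⟩
      · rintro (rfl | ⟨hc, hmc, hct⟩)
        · exact ⟨hmS, hsm, hmt⟩
        · exact ⟨hc, hsm.trans hmc, hct⟩
    have hnot : m ∉ F.finite_criticalValues.toFinset.filter fun c => m < c ∧ c ≤ t := by simp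
    rw [hsplit, Finset.card_insert_of_notMem hnot] at hn
    rw [hsplit, Finset.sum_insert hnot, ih _ (by omega) hmt rfl, hF.before_eq hsm]
    · ring
    · intro c hc hcm
      by_contra! hsc
      exact (hmin c (Finset.mem_filter.2 ⟨hc, hsc, hcm.le.trans hmt⟩)).not_gt hcm

theorem FinitelyGenerated.sum_jumps_le (hF : F.FinitelyGenerated)
    (Ψ : PreAbstractSimplicialComplex V → ℤ) (t : ℝ) :
    ∑ c ∈ F.finite_criticalValues.toFinset with c ≤ t,
      (Ψ (F.complex c) - Ψ (F.before c)) = Ψ (F.complex t) - Ψ ⊥ := by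
  obtain ⟨s, hs⟩ : ∃ s, ∀ c ∈ F.finite_criticalValues.toFinset ∪ {t}, s < c := by
    obtain ⟨m, hm⟩ := Finset.bddBelow (F.finite_criticalValues.toFinset ∪ {t})
    exact ⟨m - 1, fun c hc => (sub_one_lt m).trans_le (hm hc)⟩
  have hst : s < t := hs t (by simp)
  have hbot : F.complex s = ⊥ := by
    refine le_antisymm (fun σ hσ => ?_) bot_le
    obtain ⟨c, hc, hcs, -⟩ := hF.exists_critical hσ
    exact absurd hcs (hs c (Finset.mem_union_left _ hc)).not_ge
  rw [← hbot, ← hF.sum_jumps Ψ hst.le]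
  refine Finset.sum_congr (Finset.filter_congr fun c hc => ?_) fun _ _ => rfl
  simp [hs c (Finset.mem_union_left _ hc)]

theorem FinitelyGenerated.sum_jumps_gt (hF : F.FinitelyGenerated)
    (Ψ : PreAbstractSimplicialComplex V → ℤ) (t : ℝ) :
    ∑ c ∈ F.finite_criticalValues.toFinset with t < c,
      (Ψ (F.complex c) - Ψ (F.before c)) = Ψ F.total - Ψ (F.complex t) := by
  obtain ⟨u, hu⟩ := (F.finite_criticalValues.toFinset ∪ {t}).exists_le
  have htu : t ≤ u := hu t (by simp)
  have htot : F.total = F.complex u := by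
    refine le_antisymm (iSup_le fun v σ hσ => ?_) (F.complex_le_total u)
    obtain ⟨c, hc, -, hσc⟩ := hF.exists_critical hσ
    exact F.mono (hu c (Finset.mem_union_left _ hc)) hσc
  rw [htot, ← hF.sum_jumps Ψ htu]
  refine Finset.sum_congr (Finset.filter_congr fun c hc => ?_) fun _ _ => rfl
  simp [hu c (Finset.mem_union_left _ hc)]

variable [LinearOrder V] (𝕜 : Type*) [Field 𝕜]

/-- The truncation at `0` in the definition of multiplicities is harmless. -/
theorem multiplicity_eq (F : Filtration K) (k : ℕ) {a b : ℝ} (h : a < b) :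
    (F.multiplicity 𝕜 k h : ℤ) =
      ((finrankBounding 𝕜 (F.complex a) (F.complex b) k : ℤ) -
        finrankBounding 𝕜 (F.complex a) (F.before b) k) -
      ((finrankBounding 𝕜 (F.before a) (F.complex b) k : ℤ) -
        finrankBounding 𝕜 (F.before a) (F.before b) k) := by
  have hs := finrankBounding_supermodular 𝕜 (F.finite_faces_complex a) (F.before_le a)
    (F.before_le b) k
  have h₁ := persistentBetti_add 𝕜 (F.finite_faces_complex a) (F.le_before h) k
  have h₂ := persistentBetti_add 𝕜 (F.finite_faces_complex a) (F.mono h.le) k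
  have h₃ := persistentBetti_add 𝕜 (F.finite_faces_before a)
    ((F.before_le a).trans (F.le_before h)) k
  have h₄ := persistentBetti_add 𝕜 (F.finite_faces_before a)
    ((F.before_le a).trans (F.mono h.le)) k
  rw [multiplicity]
  omega

theorem multiplicityTop_eq (F : Filtration K) (k : ℕ) (a : ℝ) :
    (F.multiplicityTop 𝕜 k a : ℤ) =
      ((Module.finrank 𝕜 (cycles 𝕜 (F.complex a) k) : ℤ) -
        finrankBounding 𝕜 (F.complex a) F.total k) -
      ((Module.finrank 𝕜 (cycles 𝕜 (F.before a) k) : ℤ) -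
        finrankBounding 𝕜 (F.before a) F.total k) := by
  have h₁ := persistentBetti_add 𝕜 (F.finite_faces_complex a) (F.complex_le_total a) k
  have h₂ := persistentBetti_add 𝕜 (F.finite_faces_before a)
    ((F.before_le a).trans (F.complex_le_total a)) k
  have hle : persistentBetti 𝕜 ((F.before_le a).trans (F.complex_le_total a)) k ≤
      persistentBetti 𝕜 (F.complex_le_total a) k := by
    have := finiteDimensional_cycles 𝕜 (F.finite_faces_complex a) k
    refine Submodule.finrank_mono ?_
    rintro _ ⟨x, rfl⟩
    obtain ⟨x, rfl⟩ := Submodule.mkQ_surjective _ x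
    exact ⟨homologyMap 𝕜 (F.before_le a) k (Submodule.mkQ _ x), rfl⟩
  rw [multiplicityTop]
  omega

/-- The bars of the degree `k` diagram alive at time `t` number `dim H_k(F_t)`. Summing the
multiplicities first over the deaths after `t`, then over the births up to `t`, telescopes. -/
theorem FinitelyGenerated.barsAlive_persistenceDiagram (hF : F.FinitelyGenerated) (k : ℕ)
    (t : ℝ) :
    barsAlive t (F.persistenceDiagram 𝕜 k) = betti 𝕜 (F.complex t) k := by
  have hdeath : ∀ a ∈ F.finite_criticalValues.toFinset, barsAlive t
      ((∑ b ∈ F.finite_criticalValues.toFinset,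
        if h : a < b then F.multiplicity 𝕜 k h • {((a, (b : WithTop ℝ)) : Bar)} else 0) +
      F.multiplicityTop 𝕜 k a • {((a, ⊤) : Bar)}) = if a ≤ t then
        ((Module.finrank 𝕜 (cycles 𝕜 (F.complex a) k) : ℤ) -
          finrankBounding 𝕜 (F.complex a) (F.complex t) k) -
        ((Module.finrank 𝕜 (cycles 𝕜 (F.before a) k) : ℤ) -
          finrankBounding 𝕜 (F.before a) (F.complex t) k) else 0 := by
    intro a _
    rw [map_add, map_sum, map_nsmul, barsAlive_top]
    split_ifs with hat
    · have hbar : ∀ b ∈ F.finite_criticalValues.toFinset, barsAlive t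
          (if h : a < b then F.multiplicity 𝕜 k h • {((a, (b : WithTop ℝ)) : Bar)} else 0) =
          if t < b then ((finrankBounding 𝕜 (F.complex a) (F.complex b) k : ℤ) -
            finrankBounding 𝕜 (F.before a) (F.complex b) k) -
            ((finrankBounding 𝕜 (F.complex a) (F.before b) k : ℤ) -
            finrankBounding 𝕜 (F.before a) (F.before b) k) else 0 := by
        intro b _
        by_cases htb : t < b
        · rw [dif_pos (hat.trans_lt htb), if_pos htb, map_nsmul, barsAlive_coe, if_pos hat,
            if_neg htb.not_ge, nsmul_eq_mul, multiplicity_eq]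
          ring
        · rw [if_neg htb]
          split_ifs with h
          · rw [map_nsmul, barsAlive_coe, if_pos hat, if_pos (not_lt.1 htb), sub_self, smul_zero]
          · exact map_zero _
      rw [Finset.sum_congr rfl hbar, ← Finset.sum_filter,
        hF.sum_jumps_gt (fun L => (finrankBounding 𝕜 (F.complex a) L k : ℤ) -
          finrankBounding 𝕜 (F.before a) L k), nsmul_eq_mul, multiplicityTop_eq]
      ring
    · rw [smul_zero, add_zero]
      refine Finset.sum_eq_zero fun b _ => ?_
      split_ifs with h
      · have : ¬ b ≤ t := fun hb => hat (h.le.trans hb)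
        rw [map_nsmul, barsAlive_coe, if_neg hat, if_neg this, sub_self, smul_zero]
      · exact map_zero _
  have hbot : cycles 𝕜 (⊥ : PreAbstractSimplicialComplex V) k = ⊥ := by
    have he : {σ : Finset V | σ ∈ (⊥ : PreAbstractSimplicialComplex V).faces ∧
        σ.card = k + 1} = ∅ := Set.eq_empty_of_forall_notMem fun σ hσ => hσ.1
    rw [cycles, chains, he, Finsupp.supported_empty, bot_inf_eq]
  rw [persistenceDiagram, map_sum, Finset.sum_congr rfl hdeath, ← Finset.sum_filter,
    hF.sum_jumps_le (fun L => (Module.finrank 𝕜 (cycles 𝕜 L k) : ℤ) -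
      finrankBounding 𝕜 L (F.complex t) k),
    ← persistentBetti_add 𝕜 (F.finite_faces_complex t) le_rfl, finrankBounding, finrankBounding,
    hbot, bot_inf_eq, finrank_bot]
  push_cast
  ring

/-- The Euler curve is the alternating sum over degrees of the numbers of bars alive. -/
theorem FinitelyGenerated.eulerCurve_eq (hF : F.FinitelyGenerated) {n : ℕ}
    (hn : ∀ σ ∈ K.faces, σ.card ≤ n) (t : ℝ) :
    F.eulerCurve t = ∑ k ∈ Finset.range n,
      (-1) ^ k * barsAlive t (F.persistenceDiagram 𝕜 k) := by
  simp only [hF.barsAlive_persistenceDiagram 𝕜]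
  exact eulerChar_eq_sum_betti 𝕜 (F.finiteComplex t) fun σ hσ => hn σ (F.complex_le t hσ)

end Filtration

/-! ### Signed barcodes from diagrams -/

/-- The sum over the degrees `k < n` of the multisets `A k` for `k` even and `B k` for `k` odd. -/
def alternate (n : ℕ) (A B : ℕ → Multiset ℝ) : Multiset ℝ :=
  ∑ k ∈ Finset.range n, if Even k then A k else B k

theorem steps_alternate_sub (n : ℕ) (A B : ℕ → Multiset ℝ) (t : ℝ) :
    steps t (alternate n A B) - steps t (alternate n B A) =
      ∑ k ∈ Finset.range n, (-1) ^ k * (steps t (A k) - steps t (B k)) := by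
  rw [alternate, alternate, map_sum, map_sum, ← Finset.sum_sub_distrib]
  refine Finset.sum_congr rfl fun k _ => ?_
  rcases Nat.even_or_odd k with h | h
  · simp [h]
  · simp [Nat.not_even_iff_odd.2 h, h.neg_one_pow]

theorem Matched.alternate {n : ℕ} {A B A' B' : ℕ → Multiset ℝ} {c : ℕ → ℝ≥0∞}
    (h : ∀ k ∈ Finset.range n, Matched (A k + B' k) (A' k + B k) (c k)) :
    Matched (alternate n A B + alternate n B' A') (alternate n B A + alternate n A' B')
      (∑ k ∈ Finset.range n, c k) := by
  simp only [EulerPersistence.alternate, ← Finset.sum_add_distrib]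
  refine Matched.sum _ fun k hk => ?_
  split_ifs
  · rw [add_comm (B k)]
    exact h k hk
  · rw [add_comm (B k)]
    exact (h k hk).symm

/-- Cancelling the common part of two multisets presenting `φ` gives its signed barcode. -/
theorem isSignedBarcode_sub_inter {φ : ℝ → ℤ} {A B : Multiset ℝ}
    (h : ∀ t, φ t = steps t A - steps t B) : IsSignedBarcode φ (A - A ∩ B) (B - A ∩ B) where
  eq_sum t := by
    change φ t = steps t (A - A ∩ B) - steps t (B - A ∩ B)
    have hA := congrArg (steps t) (tsub_add_cancel_of_le (Multiset.inter_le_left (s := A) (t := B)))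
    have hB := congrArg (steps t) (tsub_add_cancel_of_le (Multiset.inter_le_right (s := A) (t := B)))
    rw [map_add] at hA hB
    rw [h, ← hA, ← hB]
    ring
  disjoint := by
    rw [Multiset.disjoint_left]
    intro x hA hB
    rw [← Multiset.count_pos, Multiset.count_sub, Multiset.count_inter] at hA hB
    omega

/-- The signed distance can be bounded by matching presentations that still have a common part,
since common points of source and target of a matching can be cancelled. -/
theorem signedWasserstein_le_of_matched {φ φ' : ℝ → ℤ} {A B A' B' : Multiset ℝ} {ε : ℝ}
    (hφ : ∀ t, φ t = steps t A - steps t B) (hφ' : ∀ t, φ' t = steps t A' - steps t B')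
    (hε : 0 < ε) (h : Matched (A + B') (B + A') (ENNReal.ofReal ε)) :
    signedWasserstein φ φ' ≤ ENNReal.ofReal ε := by
  refine sInf_le ⟨ε, hε, rfl, _, _, _, _, isSignedBarcode_sub_inter hφ,
    isSignedBarcode_sub_inter hφ', Matched.exists_equiv hε.le (Matched.cancel
      (C := A ∩ B + A' ∩ B') ?_)⟩
  rw [add_add_add_comm, add_add_add_comm (B - A ∩ B),
    tsub_add_cancel_of_le Multiset.inter_le_left, tsub_add_cancel_of_le Multiset.inter_le_right,
    tsub_add_cancel_of_le Multiset.inter_le_left, tsub_add_cancel_of_le Multiset.inter_le_right]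
  exact h

theorem FiniteComplex.exists_card_le {V : Type*} (K : FiniteComplex V) :
    ∃ n : ℕ, ∀ σ ∈ K.faces, σ.card ≤ n :=
  ⟨K.finite_faces.toFinset.sup Finset.card, fun _ hσ =>
    Finset.le_sup (f := Finset.card) (K.finite_faces.mem_toFinset.2 hσ)⟩

end EulerPersistence

end

theorem mainTheorem6 (𝕜 : Type*) [Field 𝕜]
    {V V' : Type*} [LinearOrder V] [LinearOrder V']
    {K : EulerPersistence.FiniteComplex V} {K' : EulerPersistence.FiniteComplex V'}
    (F : EulerPersistence.Filtration K) (F' : EulerPersistence.Filtration K')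
    (hF : F.FinitelyGenerated) (hF' : F'.FinitelyGenerated) :
    EulerPersistence.signedWasserstein F.eulerCurve F'.eulerCurve ≤
      2 * ∑' k : ℕ, EulerPersistence.wasserstein
        (F.persistenceDiagram 𝕜 k) (F'.persistenceDiagram 𝕜 k) := by
  open EulerPersistence in
  refine ENNReal.le_of_forall_pos_le_add fun δ hδ hfin => ?_
  obtain ⟨n₁, hn₁⟩ := K.exists_card_le
  obtain ⟨n₂, hn₂⟩ := K'.exists_card_le
  let n := max n₁ n₂
  let W : ℕ → ℝ≥0∞ := fun k => wasserstein (F.persistenceDiagram 𝕜 k) (F'.persistenceDiagram 𝕜 k)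
  have hW : ∀ k, W k ≠ ∞ := ENNReal.ne_top_of_tsum_ne_top fun h => by
    change 2 * ∑' k, W k < ∞ at hfin
    rw [h, ENNReal.mul_top two_ne_zero] at hfin
    exact hfin.ne rfl
  -- The error `δ` is shared among the degrees; the `1` keeps the denominator positive.
  let γ : ℝ≥0∞ := δ / (2 * (n + 1))
  have hγ : γ ≠ 0 := by
    simp [γ, hδ.ne', ENNReal.div_eq_zero_iff, ENNReal.mul_eq_top]
  have hM := Matched.alternate (n := n) fun k _ =>
    matched_of_wasserstein_lt (ENNReal.lt_add_right (hW k) hγ)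
  have hcost : ∑ k ∈ Finset.range n, 2 * (W k + γ) ≤ 2 * ∑' k, W k + δ := by
    rw [← Finset.mul_sum, Finset.sum_add_distrib, mul_add, Finset.sum_const, Finset.card_range]
    refine add_le_add (mul_le_mul_right (ENNReal.sum_le_tsum _) 2) ?_
    calc 2 * (n • γ) ≤ (2 * (n + 1)) * γ := by
          rw [nsmul_eq_mul, ← mul_assoc]
          gcongr
          exact le_self_add
      _ ≤ δ := ENNReal.mul_div_le
  have hR : 2 * ∑' k, W k + δ ≠ ∞ := ENNReal.add_ne_top.2 ⟨hfin.ne, ENNReal.coe_ne_top⟩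
  have hpos : 0 < (2 * ∑' k, W k + (δ : ℝ≥0∞)).toReal :=
    ENNReal.toReal_pos (by simp [hδ.ne']) hR
  have := signedWasserstein_le_of_matched
    (φ := F.eulerCurve) (φ' := F'.eulerCurve)
    (fun t => by
      rw [hF.eulerCurve_eq 𝕜 (n := n) (fun σ hσ => (hn₁ σ hσ).trans (le_max_left _ _)),
        steps_alternate_sub]
      rfl)
    (fun t => by
      rw [hF'.eulerCurve_eq 𝕜 (n := n) (fun σ hσ => (hn₂ σ hσ).trans (le_max_right _ _)),
        steps_alternate_sub]
      rfl) hpos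
    ((hM.mono hcost).mono (ENNReal.ofReal_toReal hR).ge)
  rwa [ENNReal.ofReal_toReal hR] at this
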